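/- Let $\mathcal{H}$ be the complex upper half plane and $\mathrm{Hol}$ the $\mathbb{C}$-algebra of holomorphic functions on $\mathcal{H}$. Put $H_n=\mathrm{Hol}$ for every $n\in\mathbb{R}$ and $H=\bigoplus_{n\in\mathbb{R}}H_n$, and write $(f,n)$ for $f\in\mathrm{Hol}$ regarded as an element of $H_n$. For $i\in\mathbb{R}$ let $\mathrm{End}^i(H)$ be the space of $\mathbb{C}$-linear maps $\phi:H\to H$ with $\phi(H_n)\subset H_{n+i}$ for all $n\in\mathbb{R}$, and let $\mathrm{End}(H)=\bigoplus_{i\in\mathbb{R}}\mathrm{End}^i(H)$, a $\mathbb{C}$-algebra under composition. Let $E_k=1+O(q)$, $q=e^{2\pi i z}$, be the normalized Eisenstein series of weight $k$ for $\mathrm{SL}(2,\mathbb{Z})$ ($k=2,4,6$), and for $n\in\mathbb{R}$ let $D_nf=\frac{1}{2\pi i}\frac{df}{dz}-\frac{n}{12}E_2f$ for $f\in\mathrm{Hol}$. Let $\delta\in\mathrm{End}^2(H)$, $e_4\in\mathrm{End}^4(H)$ and $e_6\in\mathrm{End}^6(H)$ be the linear maps given by $$\delta(f,n)=(D_nf,n+2),\qquad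 e_4(f,n)=(E_4f,n+4),\qquad e_6(f,n)=(E_6f,n+6),$$ and let $\mathcal{R}$ be the (unital) $\mathbb{C}$-subalgebra of $\mathrm{End}(H)$ generated by $\delta$, $e_4$ and $e_6$. Theorem. The family $(e_4^i e_6^j\delta^k)_{i,j,k\in\mathbb{Z}_{\ge0}}$ is a $\mathbb{C}$-basis of $\mathcal{R}$. -/

import Mathlib

open scoped Manifold DirectSum

noncomputable section

namespace MLDO

/-- The algebra `Hol` of holomorphic functions on the upper half plane. -/
def Hol : Subalgebra ℂ (UpperHalfPlane → ℂ) where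
  carrier := {f | MDiff f}
  mul_mem' hf hg := MDifferentiable.mul hf hg
  add_mem' hf hg := MDifferentiable.add hf hg
  algebraMap_mem' _ := mdifferentiable_const

/-- The space `H = ⨁_{n ∈ ℝ} H_n` with `H_n = Hol` for every `n`. -/
def H : Type := ⨁ _ : ℝ, Hol

instance : AddCommGroup H := inferInstanceAs (AddCommGroup (⨁ _ : ℝ, Hol))

instance : Module ℂ H := inferInstanceAs (Module ℂ (⨁ _ : ℝ, Hol))

/-- The element `(f, n)` of `H`, that is `f` viewed in `H_n`, as a linear map in `f`. -/
def inc (n : ℝ) : Hol →ₗ[ℂ] H := DirectSum.lof ℂ ℝ (fun _ => Hol) n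

/-- The component in `H_n` of an element of `H`. -/
def comp (n : ℝ) : H →ₗ[ℂ] Hol := DirectSum.component ℂ ℝ (fun _ => Hol) n

/-- The linear map on `H` that is given by `φ n` on `H_n`. -/
def liftH {V : Type} [AddCommGroup V] [Module ℂ V] (φ : ℝ → Hol →ₗ[ℂ] V) : H →ₗ[ℂ] V :=
  DirectSum.toModule ℂ ℝ V φ

@[simp]
lemma comp_inc_self (n : ℝ) (f : Hol) : comp n (inc n f) = f :=
  DirectSum.component.lof_self ℂ (M := fun _ : ℝ => Hol) n f

lemma comp_inc_of_ne {m n : ℝ} (h : m ≠ n) (f : Hol) : comp m (inc n f) = 0 :=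
  DirectSum.of_eq_of_ne (β := fun _ : ℝ => Hol) n m f h

@[simp]
lemma liftH_inc {V : Type} [AddCommGroup V] [Module ℂ V] (φ : ℝ → Hol →ₗ[ℂ] V) (n : ℝ) (f : Hol) :
    liftH φ (inc n f) = φ n f :=
  DirectSum.toModule_lof ℂ (M := fun _ : ℝ => Hol) n f

lemma hom_ext {V : Type} [AddCommGroup V] [Module ℂ V] {φ ψ : H →ₗ[ℂ] V}
    (h : ∀ n f, φ (inc n f) = ψ (inc n f)) : φ = ψ :=
  DirectSum.linearMap_ext ℂ fun n => LinearMap.ext (h n)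

/-- The subspace `H_n` of `H`. -/
def Hn (n : ℝ) : Submodule ℂ H := LinearMap.range (inc n)

/-- `End^i(H)`: the linear endomorphisms of `H` that map `H_n` into `H_{n+i}` for all `n`. -/
def EndDeg (i : ℝ) : Submodule ℂ (Module.End ℂ H) where
  carrier := {φ | ∀ n : ℝ, ∀ x ∈ Hn n, φ x ∈ Hn (n + i)}
  add_mem' hφ hψ n x hx := Submodule.add_mem _ (hφ n x hx) (hψ n x hx)
  zero_mem' _ _ _ := Submodule.zero_mem _
  smul_mem' c _ hφ n x hx := Submodule.smul_mem _ c (hφ n x hx)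

lemma one_mem_EndDeg : (1 : Module.End ℂ H) ∈ EndDeg 0 := fun n x hx => by
  simpa using hx

lemma mul_mem_EndDeg {i j : ℝ} {φ ψ : Module.End ℂ H} (hφ : φ ∈ EndDeg i) (hψ : ψ ∈ EndDeg j) :
    φ * ψ ∈ EndDeg (i + j) := fun n x hx => by
  have h := hφ _ _ (hψ n x hx)
  rwa [add_assoc, add_comm j i] at h

/-- The sum of the `EndDeg i` is direct. -/
lemma iSupIndep_EndDeg : iSupIndep EndDeg := by
  classical
  refine iSupIndep_of_dfinsupp_lsum_injective _ ?_
  refine (injective_iff_map_eq_zero _).2 fun m hm => ?_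
  ext i : 1
  refine Subtype.ext ?_
  refine hom_ext fun n f => ?_
  have key : ∀ j : ℝ, ∃ g : Hol, (m j : Module.End ℂ H) (inc n f) = inc (n + j) g := fun j => by
    obtain ⟨g, hg⟩ := (m j).2 n (inc n f) ⟨f, rfl⟩
    exact ⟨g, hg.symm⟩
  choose g hg using key
  have h0 : (DFinsupp.lsum ℕ (fun i => (EndDeg i).subtype) m) (inc n f) = 0 := by
    rw [hm]; rfl
  rw [DFinsupp.lsum_apply_apply, DFinsupp.sumAddHom_apply, DFinsupp.sum,
    LinearMap.sum_apply] at h0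
  have h1 : ∑ j ∈ m.support, inc (n + j) (g j) = 0 := by
    rw [← h0]
    exact Finset.sum_congr rfl fun j _ => (hg j).symm
  have h2 := congrArg (comp (n + i)) h1
  rw [map_sum, map_zero] at h2
  by_cases hi : i ∈ m.support
  · rw [Finset.sum_eq_single i (fun j _ hj => comp_inc_of_ne (by simpa using hj.symm) _)
      (fun h => absurd hi h), comp_inc_self] at h2
    change (m i : Module.End ℂ H) (inc n f) = 0
    rw [hg, h2, map_zero]
  · have : m i = 0 := by simpa using hi
    rw [this]; rfl

/-- The graded algebra `End(H) = ⨁_{i ∈ ℝ} End^i(H)`, as a subalgebra of the algebra of all linear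
endomorphisms of `H`. -/
def EndH : Subalgebra ℂ (Module.End ℂ H) :=
  (⨆ i, EndDeg i).toSubalgebra (Submodule.mem_iSup_of_mem 0 one_mem_EndDeg) (by
    intro x y hx hy
    have h : (⨆ i, EndDeg i) * (⨆ i, EndDeg i) ≤ ⨆ i, EndDeg i := by
      rw [Submodule.iSup_mul]
      refine iSup_le fun i => ?_
      rw [Submodule.mul_iSup]
      refine iSup_le fun j => Submodule.mul_le.2 fun a ha b hb => ?_
      exact Submodule.mem_iSup_of_mem (i + j) (mul_mem_EndDeg ha hb)
    exact h (Submodule.mul_mem_mul hx hy))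

lemma mem_EndH {i : ℝ} {φ : Module.End ℂ H} (hφ : φ ∈ EndDeg i) : φ ∈ EndH :=
  Submodule.mem_iSup_of_mem (p := EndDeg) i hφ

/-- The Ramanujan-Serre operator `D_n f = (2 π i)⁻¹ f' - (n / 12) E₂ f` on `Hol`. -/
def serreD (n : ℝ) : Hol →ₗ[ℂ] Hol where
  toFun f := ⟨Derivative.serreDerivative n f, Derivative.serreDerivative_mdifferentiable n f.2⟩
  map_add' f g := Subtype.ext (Derivative.serreDerivative_add n f g f.2 g.2)
  map_smul' c f := Subtype.ext (Derivative.serreDerivative_smul n c f f.2)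

/-- The Eisenstein series `E₄ = 1 + O(q)` as an element of `Hol`. -/
def E4 : Hol := ⟨ModularForm.E₄, ModularForm.E₄.holo'⟩

/-- The Eisenstein series `E₆ = 1 + O(q)` as an element of `Hol`. -/
def E6 : Hol := ⟨ModularForm.E₆, ModularForm.E₆.holo'⟩

/-- The endomorphism `(f, n) ↦ (T n f, n + i)` of `H`. -/
def shiftMap (i : ℝ) (T : ℝ → Hol →ₗ[ℂ] Hol) : Module.End ℂ H :=
  liftH fun n => inc (n + i) ∘ₗ T n

lemma shiftMap_inc (i : ℝ) (T : ℝ → Hol →ₗ[ℂ] Hol) (n : ℝ) (f : Hol) :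
    shiftMap i T (inc n f) = inc (n + i) (T n f) := by
  simp [shiftMap]

lemma shiftMap_mem (i : ℝ) (T : ℝ → Hol →ₗ[ℂ] Hol) : shiftMap i T ∈ EndDeg i := by
  rintro n _ ⟨f, rfl⟩
  exact ⟨T n f, (shiftMap_inc i T n f).symm⟩

/-- `δ (f, n) = (D_n f, n + 2)`. -/
def delta : EndH := ⟨shiftMap 2 serreD, mem_EndH (shiftMap_mem 2 _)⟩

/-- `e₄ (f, n) = (E₄ f, n + 4)`. -/
def e4 : EndH :=
  ⟨shiftMap 4 fun _ => LinearMap.mulLeft ℂ E4, mem_EndH (shiftMap_mem 4 _)⟩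

/-- `e₆ (f, n) = (E₆ f, n + 6)`. -/
def e6 : EndH :=
  ⟨shiftMap 6 fun _ => LinearMap.mulLeft ℂ E6, mem_EndH (shiftMap_mem 6 _)⟩

/-- The MLDO algebra `ℛ`: the subalgebra of `End(H)` generated by `δ`, `e₄`, `e₆`. -/
def R : Subalgebra ℂ EndH := Algebra.adjoin ℂ {delta, e4, e6}

end MLDO

end

open UpperHalfPlane ModularForm Derivative
open scoped Manifold MatrixGroups

namespace MLDO

/-! ### The Serre derivative of the Eisenstein series -/

/-! Spanning is a rewriting argument. The Serre derivative obeys the Leibniz rule and sends E₄ into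
ℂE₆ and E₆ into ℂE₄², because the level one spaces of weights 6 and 8 are lines; hence δ can be
moved to the right of e₄ and e₆ (`delta_mul_mem`). For independence, a relation applied to (f, 0)
and split by degree gives operators ∑ A_k D^k that kill all of `Hol`. Testing on powers of z - z₀
forces A_k = 0 (`eq_zero_of_sum_mul_iterD_eq_zero`). Each A_k combines monomials E₄^a E₆^b of one
weight, and these are independent because E₆ vanishes at the point I and E₄ does not
(`eq_zero_of_sum_E4_pow_mul_E6_pow_eq_zero`). -/

lemma isBoundedAtImInfty_normalizedDeriv {F : ℍ → ℂ} (hF : MDiff F)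
    (hb : IsBoundedAtImInfty F) : IsBoundedAtImInfty (normalizedDerivOfComplex F) := by
  rw [isBoundedAtImInfty_iff] at hb ⊢
  obtain ⟨M, A, hMA⟩ := hb
  -- The margin 2 keeps the closed unit disc around z inside both the half plane and the region
  -- where F is bounded by M; Cauchy's estimate on that disc then bounds F'.
  refine ⟨‖(2 * Real.pi * Complex.I : ℂ)⁻¹‖ * M, max A 0 + 2, fun z hz => ?_⟩
  have him : ∀ w ∈ Metric.closedBall (z : ℂ) 1, 0 < w.im ∧ A ≤ w.im := by
    intro w hw
    have h1 : |(w - z).im| ≤ 1 :=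
      (Complex.abs_im_le_norm _).trans (by simpa [dist_eq_norm] using hw)
    rw [Complex.sub_im, coe_im] at h1
    have h2 := (abs_le.1 h1).1
    have h3 := le_max_left A 0
    have h4 := le_max_right A 0
    constructor <;> linarith
  have hd : DifferentiableOn ℂ (F ∘ ofComplex) (Metric.closedBall (z : ℂ) 1) :=
    (UpperHalfPlane.mdifferentiable_iff.1 hF).mono fun w hw => (him w hw).1
  have hderiv : ‖deriv (F ∘ ofComplex) z‖ ≤ M / 1 := by
    refine Complex.norm_deriv_le_of_forall_mem_sphere_norm_le one_pos ?_ fun w hw => ?_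
    · exact DifferentiableOn.diffContOnCl (by rwa [closure_ball _ one_ne_zero])
    · obtain ⟨h1, h2⟩ := him w (Metric.sphere_subset_closedBall hw)
      rw [Function.comp_apply, ofComplex_apply_of_im_pos h1]
      exact hMA ⟨w, h1⟩ h2
  rw [div_one] at hderiv
  simp only [normalizedDerivOfComplex, norm_mul]
  gcongr

/-- The Serre derivative of a modular form of level one. -/
noncomputable def serreModularForm {k : ℤ} (f : ModularForm 𝒮ℒ k) : ModularForm 𝒮ℒ (k + 2) where
  toFun := serreDerivative k f
  slash_action_eq' A hA := by
    obtain ⟨A, rfl⟩ := hA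
    exact serreDerivative_slash_invariant f.holo'
      (f.slash_action_eq' _ (MonoidHom.mem_range.2 ⟨A, rfl⟩))
  holo' := serreDerivative_mdifferentiable _ f.holo'
  bdd_at_cusps' hc := by
    -- SL(2,ℤ) moves every cusp to ∞ and the Serre derivative is invariant, so boundedness at ∞
    -- suffices.
    rw [Subgroup.IsArithmetic.isCusp_iff_isCusp_SL2Z] at hc
    rw [OnePoint.isBoundedAt_iff_forall_SL2Z hc]
    intro A _
    have hs : serreDerivative k f ∣[k + 2] A = serreDerivative k f :=
      serreDerivative_slash_invariant f.holo'
        (f.slash_action_eq' _ (MonoidHom.mem_range.2 ⟨A, rfl⟩))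
    rw [hs]
    have hf : IsBoundedAtImInfty f := ModularFormClass.bdd_at_infty f
    have hE : IsBoundedAtImInfty (((k : ℂ) * 12⁻¹) • EisensteinSeries.E2) :=
      EisensteinSeries.isBoundedAtImInfty_E2.const_smul_left _
    have := (isBoundedAtImInfty_normalizedDeriv f.holo' hf).sub (hE.mul hf)
    exact this

/-- The space of weight 6 is spanned by E₆. The value of c plays no role in the basis theorem. -/
lemma exists_serreD_E4 : ∃ c : ℂ, serreD 4 E4 = c • E6 := by
  obtain ⟨c, hc⟩ := (finrank_eq_one_iff_of_nonzero' E₆ (EisensteinSeries.E_ne_zero _ ⟨3, rfl⟩)).mp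
    (Module.rank_eq_one_iff_finrank_eq_one.mp levelOne_weight_six_rank_one)
    (serreModularForm E₄)
  refine ⟨c, Subtype.ext ?_⟩
  have h : serreDerivative ((4 : ℤ) : ℂ) E₄ = c • (E₆ : ℍ → ℂ) :=
    congrArg (fun f : ModularForm 𝒮ℒ 6 => (f : ℍ → ℂ)) hc.symm
  have hw : ((4 : ℤ) : ℂ) = ((4 : ℝ) : ℂ) := by norm_num
  rw [hw] at h
  exact h

lemma exists_serreD_E6 : ∃ c : ℂ, serreD 6 E6 = c • (E4 * E4) := by
  have h0 : E₄.mul E₄ ≠ 0 := fun h => by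
    have h1 : (E₄ : ℍ → ℂ) * E₄ = 0 := congrArg (fun f : ModularForm 𝒮ℒ 8 => (f : ℍ → ℂ)) h
    have h2 : (E₄ : ℍ → ℂ) = 0 :=
      or_self_iff.1 ((UpperHalfPlane.mul_eq_zero_iff E₄.holo' E₄.holo').1 h1)
    exact EisensteinSeries.E_ne_zero (k := 4) (by norm_num) ⟨2, rfl⟩ (DFunLike.coe_injective h2)
  have hr : Module.rank ℂ (ModularForm 𝒮ℒ 8) = 1 := by
    simpa [Nat.ModEq] using dimension_level_one 8 ⟨4, rfl⟩
  obtain ⟨c, hc⟩ := (finrank_eq_one_iff_of_nonzero' (E₄.mul E₄) h0).mp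
    (Module.rank_eq_one_iff_finrank_eq_one.mp hr) (serreModularForm E₆)
  refine ⟨c, Subtype.ext ?_⟩
  have h : serreDerivative ((6 : ℤ) : ℂ) E₆ = c • ((E₄ : ℍ → ℂ) * E₄) :=
    congrArg (fun f : ModularForm 𝒮ℒ 8 => (f : ℍ → ℂ)) hc.symm
  have hw : ((6 : ℤ) : ℂ) = ((6 : ℝ) : ℂ) := by norm_num
  rw [hw] at h
  exact h

/-! ### Values of E₄ and E₆ at the point I -/

lemma E6_ne_zero : E6 ≠ 0 := fun h =>
  EisensteinSeries.E_ne_zero (k := 6) (by norm_num) ⟨3, rfl⟩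
    (DFunLike.coe_injective (congrArg Subtype.val h))

/-- S fixes I, so weight 6 modularity reads I⁻⁶ E₆(I) = E₆(I), where I⁻⁶ = -1. -/
lemma E6_apply_I : E6.1 UpperHalfPlane.I = 0 := by
  have h := congrFun (E₆.slash_action_eq' _ (MonoidHom.mem_range.2 ⟨ModularGroup.S, rfl⟩))
    UpperHalfPlane.I
  have h' : ((E₆ : ℍ → ℂ) ∣[(6 : ℤ)] ModularGroup.S) UpperHalfPlane.I = E₆ UpperHalfPlane.I := h
  have hS : ModularGroup.S • UpperHalfPlane.I = UpperHalfPlane.I := by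
    rw [UpperHalfPlane.modular_S_smul]
    ext
    simp
  rw [SL_slash_apply, hS, ModularGroup.denom_S] at h'
  have hI : ((UpperHalfPlane.I : ℍ) : ℂ) ^ (-6 : ℤ) = -1 := by
    rw [UpperHalfPlane.coe_I, zpow_neg, show (6 : ℤ) = ((6 : ℕ) : ℤ) by rfl, zpow_natCast,
      show (6 : ℕ) = 4 + 2 by rfl, pow_add, Complex.I_pow_four, Complex.I_sq]
    norm_num
  rw [hI] at h'
  change E₆ UpperHalfPlane.I = 0
  linear_combination (-1 / 2) * h'

/-- Otherwise the discriminant, a multiple of E₄³ - E₆², would vanish at I. -/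
lemma E4_apply_I_ne_zero : E4.1 UpperHalfPlane.I ≠ 0 := fun h => by
  have h4 : E₄ UpperHalfPlane.I = 0 := h
  have h6 : E₆ UpperHalfPlane.I = 0 := E6_apply_I
  apply discriminant_ne_zero UpperHalfPlane.I
  rw [discriminant_eq_E₄_cube_sub_E₆_sq, h4, h6]
  norm_num

end MLDO

namespace MLDO

/-! ### Iterated Serre derivatives and vanishing orders -/

lemma Hol.mul_eq_zero {f g : Hol} (h : f * g = 0) : f = 0 ∨ g = 0 :=
  ((UpperHalfPlane.mul_eq_zero_iff f.2 g.2).1 (congrArg Subtype.val h)).imp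
    (fun h => Subtype.ext h) (fun h => Subtype.ext h)

instance : NoZeroDivisors Hol := ⟨Hol.mul_eq_zero⟩

/-- Evaluation at a point, as an algebra homomorphism. -/
noncomputable def evalAt (z : ℍ) : Hol →ₐ[ℂ] ℂ := (Pi.evalAlgHom ℂ (fun _ : ℍ => ℂ) z).comp Hol.val

lemma Hol.ext_evalAt {f g : Hol} (h : ∀ z, evalAt z f = evalAt z g) : f = g :=
  Subtype.ext (funext h)

lemma serreD_mul (m n : ℝ) (f g : Hol) :
    serreD (m + n) (f * g) = serreD m f * g + f * serreD n g := by
  refine Subtype.ext ?_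
  have := serreDerivative_mul m n f.1 g.1 f.2 g.2
  rw [← Complex.ofReal_add] at this
  exact this

/-- The function `z ↦ z - z₀`. -/
noncomputable def subPt (z₀ : ℍ) : Hol :=
  ⟨fun z => (z : ℂ) - z₀, UpperHalfPlane.mdifferentiable_coe.sub mdifferentiable_const⟩

@[simp]
lemma evalAt_subPt (z₀ : ℍ) : evalAt z₀ (subPt z₀) = 0 := sub_self (z₀ : ℂ)

/-- The constant `(2 π i)⁻¹`. -/
noncomputable def invTwoPiI : ℂ := (2 * Real.pi * Complex.I)⁻¹

lemma invTwoPiI_ne_zero : invTwoPiI ≠ 0 := inv_ne_zero Complex.two_pi_I_ne_zero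

lemma serreD_zero_subPt (z₀ : ℍ) : serreD 0 (subPt z₀) = invTwoPiI • 1 := by
  refine Subtype.ext (funext fun z => ?_)
  have h : deriv ((subPt z₀).1 ∘ ofComplex) z = 1 := by
    have he : ((subPt z₀).1 ∘ ofComplex) =ᶠ[nhds (z : ℂ)] fun w => w - z₀ := by
      filter_upwards [isOpen_upperHalfPlaneSet.mem_nhds z.im_pos] with w hw
      simp [subPt, ofComplex_apply_of_im_pos hw]
    rw [he.deriv_eq]
    simp
  simp [serreD, normalizedDerivOfComplex, h, invTwoPiI]

/-- Giving z - z₀ weight 0 removes the E₂ term from its Serre derivative, which becomes a nonzero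
constant; the Leibniz rule then lowers the order of vanishing at z₀ by one. -/
lemma serreD_subPt_pow_mul (z₀ : ℍ) (m : ℕ) (n : ℝ) (g : Hol) :
    serreD n (subPt z₀ ^ (m + 1) * g) =
      subPt z₀ ^ m * (((m + 1) * invTwoPiI) • g + subPt z₀ * serreD n g) := by
  have step : ∀ f : Hol, serreD n (subPt z₀ * f) = invTwoPiI • f + subPt z₀ * serreD n f := by
    intro f
    have := serreD_mul 0 n (subPt z₀) f
    rwa [zero_add, serreD_zero_subPt, smul_one_mul] at this
  induction m with
  | zero => simp [step]
  | succ m ih =>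
    rw [pow_succ' _ (m + 1), mul_assoc, step, ih]
    simp only [Algebra.smul_def, map_mul, map_add, map_natCast, map_one, Nat.cast_add,
      Nat.cast_one, pow_succ]
    ring

/-- The `k`-fold iterate of the Serre derivative, starting in weight `n`. -/
noncomputable def iterD : ℕ → ℝ → Hol →ₗ[ℂ] Hol
  | 0, _ => LinearMap.id
  | k + 1, n => serreD (n + 2 * k) ∘ₗ iterD k n

/-- Each derivative removes one factor z - z₀ and multiplies the leading coefficient by a nonzero
constant. -/
lemma exists_iterD_subPt_pow_mul (z₀ : ℍ) (n : ℝ) (k m : ℕ) (g : Hol) :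
    ∃ h : Hol, iterD k n (subPt z₀ ^ (m + k) * g) = subPt z₀ ^ m * h ∧
      (evalAt z₀ g ≠ 0 → evalAt z₀ h ≠ 0) := by
  induction k generalizing m with
  | zero => exact ⟨g, rfl, id⟩
  | succ k ih =>
    obtain ⟨h, h1, h2⟩ := ih (m + 1)
    refine ⟨((m + 1) * invTwoPiI) • h + subPt z₀ * serreD (n + 2 * k) h, ?_, fun hg => ?_⟩
    · rw [iterD, LinearMap.comp_apply, show m + (k + 1) = m + 1 + k by ring, h1,
        serreD_subPt_pow_mul]
    · simpa [invTwoPiI_ne_zero, h2 hg] using Nat.cast_add_one_ne_zero m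

lemma eq_zero_of_sum_mul_iterD_eq_zero (n : ℝ) (A : ℕ → Hol) (N : ℕ)
    (h : ∀ f, ∑ k ∈ Finset.range N, A k * iterD k n f = 0) : ∀ k < N, A k = 0 := by
  induction N with
  | zero => intro k hk; exact absurd hk (Nat.not_lt_zero k)
  | succ N ih =>
    have hN : A N = 0 := Hol.ext_evalAt fun z₀ => by
      -- Fewer than N derivatives of (z - z₀)^N still vanish at z₀, while the N-th does not; only
      -- A_N(z₀) times a nonzero number survives.
      have h0 := congrArg (evalAt z₀) (h (subPt z₀ ^ N * 1))
      rw [Finset.sum_range_succ, map_add, map_sum, Finset.sum_eq_zero, zero_add, map_zero,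
        map_mul] at h0
      · obtain ⟨u, hu, hne⟩ := exists_iterD_subPt_pow_mul z₀ n N 0 1
        rw [zero_add, pow_zero, one_mul] at hu
        rw [hu] at h0
        rw [map_zero]
        exact (mul_eq_zero.1 h0).resolve_right (hne (by simp))
      · intro k hk
        have hk := Finset.mem_range.1 hk
        obtain ⟨u, hu, -⟩ := exists_iterD_subPt_pow_mul z₀ n k (N - k) 1
        rw [Nat.sub_add_cancel hk.le] at hu
        rw [hu]
        simp [(Nat.sub_pos_of_lt hk).ne']
    intro k hk
    rcases Nat.lt_succ_iff_lt_or_eq.1 hk with hk | rfl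
    · refine ih (fun f => ?_) k hk
      have := h f
      rwa [Finset.sum_range_succ, hN, zero_mul, add_zero] at this
    · exact hN

/-- Divide by the least power of E₆ that has a nonzero coefficient and evaluate at I: distinct
E₆-exponents leave a single term, a nonzero multiple of a power of E₄(I). -/
lemma eq_zero_of_sum_E4_pow_mul_E6_pow_eq_zero {ι : Type*} (s : Finset ι) (i j : ι → ℕ)
    (hj : Set.InjOn j s) (a : ι → ℂ) (h : ∑ p ∈ s, a p • (E4 ^ i p * E6 ^ j p) = 0) :
    ∀ p ∈ s, a p = 0 := by
  classical
  by_contra! hne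
  obtain ⟨p, hp, hap⟩ := hne
  obtain ⟨p₀, hp₀, hmin⟩ := (s.filter fun p => a p ≠ 0).exists_min_image j
    ⟨p, Finset.mem_filter.2 ⟨hp, hap⟩⟩
  obtain ⟨hp₀s, hap₀⟩ := Finset.mem_filter.1 hp₀
  -- Truncation in `j p - j p₀` occurs only where `a p = 0`.
  have hfac : E6 ^ j p₀ * ∑ p ∈ s, a p • (E4 ^ i p * E6 ^ (j p - j p₀)) = 0 := by
    rw [← h, Finset.mul_sum]
    refine Finset.sum_congr rfl fun p hp => ?_
    by_cases hap : a p = 0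
    · simp [hap]
    · have hle := hmin p (Finset.mem_filter.2 ⟨hp, hap⟩)
      rw [mul_smul_comm, mul_left_comm, ← pow_add, Nat.add_sub_cancel' hle]
  have h0 := congrArg (evalAt UpperHalfPlane.I)
    ((mul_eq_zero.1 hfac).resolve_left (pow_ne_zero _ E6_ne_zero))
  have h6 : evalAt UpperHalfPlane.I E6 = 0 := E6_apply_I
  rw [map_sum, map_zero, Finset.sum_eq_single_of_mem p₀ hp₀s] at h0
  · rw [map_smul, map_mul, map_pow, map_pow, Nat.sub_self, pow_zero, mul_one, smul_eq_mul] at h0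
    exact (mul_ne_zero hap₀ (pow_ne_zero _ E4_apply_I_ne_zero)) h0
  · intro p hp hpp
    by_cases hap : a p = 0
    · simp [hap]
    · have hle := hmin p (Finset.mem_filter.2 ⟨hp, hap⟩)
      have hlt : j p₀ < j p := lt_of_le_of_ne hle fun he => hpp (hj hp hp₀s he.symm)
      simp [h6, (Nat.sub_pos_of_lt hlt).ne']

end MLDO

namespace MLDO

/-! ### The monomials span `R` -/

/-- The element `e₄ ^ i * e₆ ^ j * δ ^ k`. -/
noncomputable def monomial (p : ℕ × ℕ × ℕ) : EndH := e4 ^ p.1 * e6 ^ p.2.1 * delta ^ p.2.2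

lemma EndH.hom_ext {x y : EndH}
    (h : ∀ n f, (x : Module.End ℂ H) (inc n f) = (y : Module.End ℂ H) (inc n f)) : x = y :=
  Subtype.ext (MLDO.hom_ext h)

@[simp]
lemma delta_inc (n : ℝ) (f : Hol) :
    (delta : Module.End ℂ H) (inc n f) = inc (n + 2) (serreD n f) := shiftMap_inc _ _ _ _

@[simp]
lemma e4_inc (n : ℝ) (f : Hol) :
    (e4 : Module.End ℂ H) (inc n f) = inc (n + 4) (E4 * f) := shiftMap_inc _ _ _ _

@[simp]
lemma e6_inc (n : ℝ) (f : Hol) :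
    (e6 : Module.End ℂ H) (inc n f) = inc (n + 6) (E6 * f) := shiftMap_inc _ _ _ _

lemma e6_mul_e4 : e6 * e4 = e4 * e6 := EndH.hom_ext fun n f => by
  simp only [MulMemClass.coe_mul, Module.End.mul_apply, e4_inc, e6_inc]
  rw [mul_left_comm, add_right_comm]

lemma exists_delta_mul_e4 : ∃ c : ℂ, delta * e4 = e4 * delta + c • e6 := by
  obtain ⟨c, hc⟩ := exists_serreD_E4
  refine ⟨c, EndH.hom_ext fun n f => ?_⟩
  have h := serreD_mul 4 n E4 f
  rw [hc, add_comm 4 n] at h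
  simp only [MulMemClass.coe_mul, Module.End.mul_apply, delta_inc, e4_inc, e6_inc,
    AddMemClass.coe_add, SetLike.val_smul, LinearMap.add_apply, LinearMap.smul_apply, h]
  rw [show n + 4 + 2 = n + 6 by ring, show n + 2 + 4 = n + 6 by ring, map_add, smul_mul_assoc,
    map_smul, add_comm]

lemma exists_delta_mul_e6 : ∃ c : ℂ, delta * e6 = e6 * delta + c • (e4 * e4) := by
  obtain ⟨c, hc⟩ := exists_serreD_E6
  refine ⟨c, EndH.hom_ext fun n f => ?_⟩
  have h := serreD_mul 6 n E6 f
  rw [hc, add_comm 6 n] at h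
  simp only [MulMemClass.coe_mul, Module.End.mul_apply, delta_inc, e4_inc, e6_inc,
    AddMemClass.coe_add, SetLike.val_smul, LinearMap.add_apply, LinearMap.smul_apply, h]
  rw [show n + 6 + 2 = n + 8 by ring, show n + 2 + 6 = n + 8 by ring,
    show n + 4 + 4 = n + 8 by ring, map_add, smul_mul_assoc, map_smul, mul_assoc, add_comm]

/-- The span of the monomials `e₄ ^ i * e₆ ^ j * δ ^ k`. -/
noncomputable def monomialSpan : Submodule ℂ EndH := Submodule.span ℂ (Set.range monomial)

lemma monomial_mem (p : ℕ × ℕ × ℕ) : monomial p ∈ monomialSpan :=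
  Submodule.subset_span ⟨p, rfl⟩

lemma mul_mem_monomialSpan_of_forall {x : EndH} (h : ∀ p, x * monomial p ∈ monomialSpan)
    {y : EndH} (hy : y ∈ monomialSpan) : x * y ∈ monomialSpan := by
  have hle : monomialSpan ≤ monomialSpan.comap (LinearMap.mulLeft ℂ x) :=
    Submodule.span_le.2 (by rintro _ ⟨p, rfl⟩; exact h p)
  exact hle hy

lemma e4_mul_mem {y : EndH} (hy : y ∈ monomialSpan) : e4 * y ∈ monomialSpan :=
  mul_mem_monomialSpan_of_forall (fun ⟨i, j, k⟩ => by
    have : e4 * monomial (i, j, k) = monomial (i + 1, j, k) := by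
      simp only [monomial, pow_succ', mul_assoc]
    rw [this]
    exact monomial_mem _) hy

lemma e6_mul_mem {y : EndH} (hy : y ∈ monomialSpan) : e6 * y ∈ monomialSpan :=
  mul_mem_monomialSpan_of_forall (fun ⟨i, j, k⟩ => by
    have hc : e6 * e4 ^ i = e4 ^ i * e6 := (show Commute e6 e4 from e6_mul_e4).pow_right i
    have : e6 * monomial (i, j, k) = monomial (i, j + 1, k) := by
      simp only [monomial, pow_succ', ← mul_assoc, hc]
    rw [this]
    exact monomial_mem _) hy

lemma delta_mul_mem {y : EndH} (hy : y ∈ monomialSpan) : delta * y ∈ monomialSpan := by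
  obtain ⟨c, hc⟩ := exists_delta_mul_e4
  obtain ⟨d, hd⟩ := exists_delta_mul_e6
  refine mul_mem_monomialSpan_of_forall (fun ⟨i, j, k⟩ => ?_) hy
  induction i with
  | zero =>
    induction j with
    | zero =>
      have : delta * monomial (0, 0, k) = monomial (0, 0, k + 1) := by
        simp [monomial, pow_succ']
      rw [this]
      exact monomial_mem _
    | succ j ih =>
      have : delta * monomial (0, j + 1, k) =
          e6 * (delta * monomial (0, j, k)) + d • (e4 * (e4 * monomial (0, j, k))) := by
        have h1 : monomial (0, j + 1, k) = e6 * monomial (0, j, k) := by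
          simp [monomial, pow_succ', mul_assoc]
        rw [h1, ← mul_assoc, hd, add_mul, smul_mul_assoc, mul_assoc, mul_assoc]
      rw [this]
      exact add_mem (e6_mul_mem ih)
        (Submodule.smul_mem _ _ (e4_mul_mem (e4_mul_mem (monomial_mem _))))
  | succ i ih =>
    have : delta * monomial (i + 1, j, k) =
        e4 * (delta * monomial (i, j, k)) + c • (e6 * monomial (i, j, k)) := by
      have h1 : monomial (i + 1, j, k) = e4 * monomial (i, j, k) := by
        simp only [monomial, pow_succ', mul_assoc]
      rw [h1, ← mul_assoc, hc, add_mul, smul_mul_assoc, mul_assoc]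
    rw [this]
    exact add_mem (e4_mul_mem ih) (Submodule.smul_mem _ _ (e6_mul_mem (monomial_mem _)))

lemma R_le_monomialSpan {x : EndH} (hx : x ∈ R) : x ∈ monomialSpan := by
  -- Stability under left multiplication passes to products, unlike plain membership; y = 1 recovers
  -- the claim.
  have key : ∀ y ∈ monomialSpan, x * y ∈ monomialSpan := by
    induction hx using Algebra.adjoin_induction with
    | mem x hx =>
      rcases hx with rfl | rfl | rfl
      exacts [fun _ => delta_mul_mem, fun _ => e4_mul_mem, fun _ => e6_mul_mem]
    | algebraMap r =>
      intro y hy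
      rw [← Algebra.smul_def]
      exact Submodule.smul_mem _ _ hy
    | add a b _ _ ha hb =>
      intro y hy
      rw [add_mul]
      exact add_mem (ha y hy) (hb y hy)
    | mul a b _ _ ha hb =>
      intro y hy
      rw [mul_assoc]
      exact ha _ (hb y hy)
  simpa using key 1 (by simpa [monomial] using monomial_mem (0, 0, 0))

lemma monomial_mem_R (p : ℕ × ℕ × ℕ) : monomial p ∈ R := by
  have hd : delta ∈ R := Algebra.subset_adjoin (by simp)
  have h4 : e4 ∈ R := Algebra.subset_adjoin (by simp)
  have h6 : e6 ∈ R := Algebra.subset_adjoin (by simp)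
  exact mul_mem (mul_mem (pow_mem h4 _) (pow_mem h6 _)) (pow_mem hd _)

/-! ### The monomials are linearly independent -/

lemma delta_pow_inc (k : ℕ) (n : ℝ) (f : Hol) :
    ((delta ^ k : EndH) : Module.End ℂ H) (inc n f) = inc (n + 2 * k) (iterD k n f) := by
  induction k with
  | zero => simp [iterD]
  | succ k ih =>
    rw [pow_succ', MulMemClass.coe_mul, Module.End.mul_apply, ih, delta_inc, iterD,
      LinearMap.comp_apply]
    congr 2
    push_cast
    ring

lemma e4_pow_inc (i : ℕ) (n : ℝ) (f : Hol) :
    ((e4 ^ i : EndH) : Module.End ℂ H) (inc n f) = inc (n + 4 * i) (E4 ^ i * f) := by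
  induction i with
  | zero => simp
  | succ i ih =>
    rw [pow_succ', MulMemClass.coe_mul, Module.End.mul_apply, ih, e4_inc, pow_succ', mul_assoc]
    congr 2
    push_cast
    ring

lemma e6_pow_inc (j : ℕ) (n : ℝ) (f : Hol) :
    ((e6 ^ j : EndH) : Module.End ℂ H) (inc n f) = inc (n + 6 * j) (E6 ^ j * f) := by
  induction j with
  | zero => simp
  | succ j ih =>
    rw [pow_succ', MulMemClass.coe_mul, Module.End.mul_apply, ih, e6_inc, pow_succ', mul_assoc]
    congr 2
    push_cast
    ring

/-- The degree of the monomial `e₄ ^ i * e₆ ^ j * δ ^ k`. -/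
def degree (p : ℕ × ℕ × ℕ) : ℕ := 4 * p.1 + 6 * p.2.1 + 2 * p.2.2

lemma monomial_inc (p : ℕ × ℕ × ℕ) (f : Hol) :
    (monomial p : Module.End ℂ H) (inc 0 f) =
      inc (degree p) (E4 ^ p.1 * E6 ^ p.2.1 * iterD p.2.2 0 f) := by
  simp only [monomial, MulMemClass.coe_mul, Module.End.mul_apply, delta_pow_inc, e6_pow_inc,
    e4_pow_inc]
  rw [← mul_assoc]
  congr 2
  simp only [degree]
  push_cast
  ring

/-- The map that sends `φ` to the component in `H_w` of `φ (f, 0)`. -/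
noncomputable def compApply (w : ℝ) (f : Hol) : EndH →ₗ[ℂ] Hol :=
  comp w ∘ₗ LinearMap.applyₗ (inc 0 f) ∘ₗ EndH.val.toLinearMap

lemma compApply_monomial (w : ℕ) (p : ℕ × ℕ × ℕ) (f : Hol) :
    compApply w f (monomial p) =
      if degree p = w then E4 ^ p.1 * E6 ^ p.2.1 * iterD p.2.2 0 f else 0 := by
  change comp w ((monomial p : Module.End ℂ H) (inc 0 f)) = _
  rw [monomial_inc]
  split_ifs with h
  · rw [h, comp_inc_self]
  · exact comp_inc_of_ne (fun h' => h (by exact_mod_cast h'.symm)) _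

/-- The coefficient of `δ ^ k` in the component of degree `w` of a linear combination of
monomials, as a function on the upper half plane. -/
noncomputable def deltaCoeff (s : Finset (ℕ × ℕ × ℕ)) (a : ℕ × ℕ × ℕ → ℂ) (w k : ℕ) : Hol :=
  ∑ q ∈ s with degree q = w ∧ q.2.2 = k, a q • (E4 ^ q.1 * E6 ^ q.2.1)

/-- Projecting to H_w isolates the monomials of degree w, which are then grouped by their power of
δ. -/
lemma sum_deltaCoeff_mul_iterD {s : Finset (ℕ × ℕ × ℕ)} {a : ℕ × ℕ × ℕ → ℂ}
    (hs : ∑ q ∈ s, a q • monomial q = 0) (w N : ℕ) (hN : ∀ q ∈ s, q.2.2 < N) (f : Hol) :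
    ∑ k ∈ Finset.range N, deltaCoeff s a w k * iterD k 0 f = 0 := by
  have h0 := congrArg (compApply w f) hs
  simp only [map_sum, map_smul, compApply_monomial, smul_ite, smul_zero, map_zero] at h0
  rw [← Finset.sum_filter] at h0
  rw [← h0, ← Finset.sum_fiberwise_of_maps_to (g := fun q : ℕ × ℕ × ℕ => q.2.2)
    (t := Finset.range N) fun q hq => Finset.mem_range.2 (hN q (Finset.mem_filter.1 hq).1)]
  refine Finset.sum_congr rfl fun k _ => ?_
  rw [deltaCoeff, Finset.sum_mul, Finset.filter_filter]
  refine Finset.sum_congr rfl fun q hq => ?_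
  rw [smul_mul_assoc, (Finset.mem_filter.1 hq).2.2]

lemma eq_zero_of_deltaCoeff_eq_zero {s : Finset (ℕ × ℕ × ℕ)} {a : ℕ × ℕ × ℕ → ℂ} {w k : ℕ}
    (h : deltaCoeff s a w k = 0) (p : ℕ × ℕ × ℕ) (hp : p ∈ s) (hw : degree p = w)
    (hk : p.2.2 = k) : a p = 0 := by
  suffices hinj : Set.InjOn (fun q : ℕ × ℕ × ℕ => q.2.1)
      (s.filter fun q => degree q = w ∧ q.2.2 = k : Finset (ℕ × ℕ × ℕ)) by
    have hmem := Finset.mem_filter (p := fun q => degree q = w ∧ q.2.2 = k).2 ⟨hp, hw, hk⟩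
    unfold deltaCoeff at h
    exact eq_zero_of_sum_E4_pow_mul_E6_pow_eq_zero (s.filter fun q => degree q = w ∧ q.2.2 = k)
      (fun q => q.1) (fun q => q.2.1) hinj a h p hmem
  -- With the degree and k fixed, 4i + 6j is fixed, so j determines i.
  rintro ⟨i, j, k⟩ hq ⟨i', j', k'⟩ hq' h
  have h1 := (Finset.mem_filter.1 (Finset.mem_coe.1 hq)).2
  have h2 := (Finset.mem_filter.1 (Finset.mem_coe.1 hq')).2
  simp only [degree] at h h1 h2
  simp only [Prod.mk.injEq]
  omega

theorem linearIndependent_monomial : LinearIndependent ℂ monomial := by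
  refine linearIndependent_iff'.2 fun s a hs p hp => ?_
  have hN : ∀ q ∈ s, q.2.2 < s.sup (fun q => q.2.2) + 1 := fun q hq =>
    Nat.lt_succ_of_le (Finset.le_sup (f := fun q : ℕ × ℕ × ℕ => q.2.2) hq)
  have h := eq_zero_of_sum_mul_iterD_eq_zero 0 (deltaCoeff s a (degree p)) _
    (sum_deltaCoeff_mul_iterD hs (degree p) _ hN) p.2.2 (hN p hp)
  exact eq_zero_of_deltaCoeff_eq_zero h p hp rfl rfl

/-- The basis of `R` that consists of the monomials `e₄ ^ i * e₆ ^ j * δ ^ k`. -/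
noncomputable def monomialBasis : Module.Basis (ℕ × ℕ × ℕ) ℂ R :=
  Module.Basis.mk (v := fun p => (⟨monomial p, monomial_mem_R p⟩ : R))
    (LinearIndependent.of_comp R.val.toLinearMap linearIndependent_monomial) (by
      rintro ⟨x, hx⟩ -
      have h : x ∈ (Submodule.span ℂ (Set.range fun p => (⟨monomial p, monomial_mem_R p⟩ : R))).map
          R.val.toLinearMap := by
        rw [Submodule.map_span, ← Set.range_comp]
        exact R_le_monomialSpan hx
      obtain ⟨y, hy, rfl⟩ := h
      exact hy)

end MLDO

theorem mainTheorem3 :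
    ∃ b : Module.Basis (ℕ × ℕ × ℕ) ℂ MLDO.R, ∀ i j k : ℕ,
      (b (i, j, k) : MLDO.EndH) = MLDO.e4 ^ i * MLDO.e6 ^ j * MLDO.delta ^ k := by
  refine ⟨MLDO.monomialBasis, fun i j k => ?_⟩
  rw [MLDO.monomialBasis, Module.Basis.mk_apply]
  rfl
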